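/- For an indeterminate $q$, write $(a;q)_k=\prod_{i=0}^{k-1}(1-aq^i)$ (with $(a;q)_0=1$) and $[n]=1+q+\cdots+q^{n-1}$. For $k\ge 0$ let $$c_q(k)=(-1)^k\,\frac{(q;q^2)_k\,(-q;q^2)_k^2}{(q^4;q^4)_k\,(-q^4;q^4)_k^2}\,[6k+1]\,q^{3k^2}\in\mathbb{Z}(q),\qquad a_q(k)=\sum_{j=0}^{k}c_q(j)\,c_q(k-j).$$ For a polynomial $P\in\mathbb{Z}[q]$ and rational functions $A,B\in\mathbb{Z}(q)$, write $A\equiv B\pmod{P}$ if $A-B=A_1/A_2$ for some $A_1,A_2\in\mathbb{Z}[q]$ with $A_2\neq 0$, $P\mid A_1$ in $\mathbb{Z}[q]$ and $\gcd(P,A_2)=1$ in $\mathbb{Z}[q]$. Then for every positive odd integer $n$, $$\sum_{k=0}^{n-1}a_q(k)\equiv 0\pmod{[n]}.$$ -/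

import Mathlib

/-- The `q`-shifted factorial `(a; q)_n = ∏_{i=0}^{n-1} (1 - a q^i)`. -/
def qShifted {R : Type*} [CommRing R] (a q : R) (n : ℕ) : R :=
  ∏ i ∈ Finset.range n, (1 - a * q ^ i)

/-- The `q`-integer `[n]_q = 1 + q + ⋯ + q^(n-1)`. -/
def qInteger {R : Type*} [CommRing R] (q : R) (n : ℕ) : R :=
  ∑ i ∈ Finset.range n, q ^ i

/-- The term
`c_q(k) = (-1)^k (q;q²)_k (-q;q²)_k² / ((q⁴;q⁴)_k (-q⁴;q⁴)_k²) [6k+1]_q q^(3k²)`. -/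
def cTerm {K : Type*} [Field K] (q : K) (k : ℕ) : K :=
  (-1) ^ k *
    ((qShifted q (q ^ 2) k * qShifted (-q) (q ^ 2) k ^ 2) /
      (qShifted (q ^ 4) (q ^ 4) k * qShifted (-q ^ 4) (q ^ 4) k ^ 2)) *
    qInteger q (6 * k + 1) * q ^ (3 * k ^ 2)

/-- The coefficient `a_q(k) = ∑_{j=0}^k c_q(j) c_q(k-j)` of the square of the series. -/
def aTerm {K : Type*} [Field K] (q : K) (k : ℕ) : K :=
  ∑ j ∈ Finset.range (k + 1), cTerm q j * cTerm q (k - j)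

/-- Congruence `A ≡ B (mod P)` of rational functions over `ℤ` modulo a polynomial `P ∈ ℤ[q]`:
`A - B` can be written as a fraction `A₁ / A₂` of integer polynomials with `P ∣ A₁` and
`gcd(P, A₂) = 1` (no common divisor in `ℤ[q]` besides units). -/
def RatCongr (P : Polynomial ℤ) (A B : RatFunc ℤ) : Prop :=
  ∃ A₁ A₂ : Polynomial ℤ, A₂ ≠ 0 ∧
    A - B = algebraMap (Polynomial ℤ) (RatFunc ℤ) A₁ / algebraMap (Polynomial ℤ) (RatFunc ℤ) A₂ ∧
    P ∣ A₁ ∧ IsRelPrime P A₂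

open Polynomial Finset

/-! ### q-shifted factorials -/

section QShifted

variable {R : Type*} [CommRing R]

/-! $[n]$ is the product of the pairwise coprime $\Phi_d$ with $d\mid n$, $d>1$, so it suffices that
the sum is regular and vanishes at a primitive $d$-th root of unity $\zeta$. There the terms factor
over blocks of length $d$: $c_q(dr+s)$ takes the value $C_r\,c_\zeta(s)$
(`exists_hasValueAt_cTerm`).

Two facts about one block suffice. If $d<2s$ then $c_\zeta(s)=0$, since $(\zeta;\zeta^2)_s$ contains
$1-\zeta^d$. And $\sum_{s<d}c_\zeta(s)=0$: this is a terminating quadratic summation at $a=q=\zeta$,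
proved by a telescoping recursion $a\mapsto aq^4$ (`sum_quadTerm_eq_zero`).

Now write the double sum as $\sum_{i<n}c(i)\sum_{j<n-i}c(j)$. Either $i$ lies in the second half of
its block and $c(i)=0$, or the inner sum stops in the second half of a block and is a sum of
complete block sums (`sum_convolution_eq_zero`). -/

theorem qShifted_zero (a q : R) : qShifted a q 0 = 1 := by simp [qShifted]

theorem qShifted_succ (a q : R) (n : ℕ) :
    qShifted a q (n + 1) = qShifted a q n * (1 - a * q ^ n) := by
  simp [qShifted, prod_range_succ]

theorem qShifted_succ' (a q : R) (n : ℕ) :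
    qShifted a q (n + 1) = (1 - a) * qShifted (a * q) q n := by
  simp [qShifted, prod_range_succ', pow_succ', mul_comm, mul_assoc]

theorem qShifted_add (a q : R) (m n : ℕ) :
    qShifted a q (m + n) = qShifted a q m * qShifted (a * q ^ m) q n := by
  simp [qShifted, prod_range_add, pow_add, mul_assoc]

theorem qShifted_eq_zero {a q : R} {m n : ℕ} (hmn : m < n) (h : a * q ^ m = 1) :
    qShifted a q n = 0 :=
  prod_eq_zero (mem_range.2 hmn) (by rw [h, sub_self])

theorem qShifted_ne_zero [IsDomain R] {a q : R} {n : ℕ} (h : ∀ i < n, a * q ^ i ≠ 1) :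
    qShifted a q n ≠ 0 :=
  prod_ne_zero_iff.2 fun i hi => sub_ne_zero.2 (h i (mem_range.1 hi)).symm

theorem qInteger_mul_one_sub (q : R) (n : ℕ) : qInteger q n * (1 - q) = 1 - q ^ n :=
  geom_sum_mul_neg q n

end QShifted

/-! ### A terminating quadratic summation -/

section Summation

variable {K : Type*} [Field K]

/-- The quotient `(a;q²)_k (-q;q²)_k² / ((q⁴;q⁴)_k (-aq³;q⁴)_k²) (-a/q)^k q^(3k²)`. -/
def quadTerm (q a : K) (k : ℕ) : K :=
  (qShifted a (q ^ 2) k * qShifted (-q) (q ^ 2) k ^ 2) /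
    (qShifted (q ^ 4) (q ^ 4) k * qShifted (-(a * q ^ 3)) (q ^ 4) k ^ 2) *
      (-a / q) ^ k * q ^ (3 * k ^ 2)

theorem quadTerm_succ_mul {q a : K} (hq : q ≠ 0) (k : ℕ) (hk : q ^ (4 * (k + 1)) ≠ 1)
    (ha : 1 + a * q ^ (3 + 4 * k) ≠ 0) :
    quadTerm q a (k + 1) * ((1 - q ^ (4 * (k + 1))) * (1 + a * q ^ (3 + 4 * k)) ^ 2) =
      quadTerm q a k * ((1 - a * q ^ (2 * k)) * (1 + q ^ (2 * k + 1)) ^ 2 *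
        (-a * q ^ (6 * k + 2))) := by
  have h1 : 1 - q ^ (4 * (k + 1)) ≠ 0 := sub_ne_zero.2 hk.symm
  have e1 : 1 - q ^ 4 * (q ^ 4) ^ k = 1 - q ^ (4 * (k + 1)) := by ring
  have e2 : 1 - -(a * q ^ 3) * (q ^ 4) ^ k = 1 + a * q ^ (3 + 4 * k) := by ring
  have e3 : 1 - a * (q ^ 2) ^ k = 1 - a * q ^ (2 * k) := by ring
  have e4 : 1 - -q * (q ^ 2) ^ k = 1 + q ^ (2 * k + 1) := by ring
  have e5 : (-a / q) ^ (k + 1) * q ^ (3 * (k + 1) ^ 2) =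
      (-a / q) ^ k * q ^ (3 * k ^ 2) * (-a * q ^ (6 * k + 2)) := by
    have : q ^ (3 * (k + 1) ^ 2) = q ^ (3 * k ^ 2) * q ^ (6 * k + 2) * q := by ring
    rw [this, pow_succ]
    field_simp
  unfold quadTerm
  rw [mul_assoc (_ / _) ((-a / q) ^ (k + 1)), e5]
  simp only [qShifted_succ, e1, e2, e3, e4]
  generalize qShifted (q ^ 4) (q ^ 4) k = A
  generalize qShifted (-(a * q ^ 3)) (q ^ 4) k = B
  generalize (1 - q ^ (4 * (k + 1))) = C at *
  generalize (1 + a * q ^ (3 + 4 * k)) = D at *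
  have : A * C * (B * D) ^ 2 = (A * B ^ 2) * (C * D ^ 2) := by ring
  rw [this, ← div_div]
  field_simp

theorem quadTerm_shift {q a : K} (hq : q ≠ 0) (k : ℕ) (ha : ∀ i, 1 + a * q ^ i ≠ 0) :
    (1 - a) * (1 - a * q ^ 2) * quadTerm q (a * q ^ 4) k * (1 + a * q ^ (3 + 4 * k)) ^ 2 =
      (1 + a * q ^ 3) ^ 2 * quadTerm q a k *
        ((1 - a * q ^ (2 * k)) * (1 - a * q ^ (2 * k + 2)) * q ^ (4 * k)) := by
  have h1 : (1 - a) * (1 - a * q ^ 2) * qShifted (a * q ^ 4) (q ^ 2) k =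
      qShifted a (q ^ 2) k * ((1 - a * q ^ (2 * k)) * (1 - a * q ^ (2 * k + 2))) := by
    have h := qShifted_succ' a (q ^ 2) (k + 1)
    rw [qShifted_succ' (a * q ^ 2), qShifted_succ, qShifted_succ] at h
    rw [show a * q ^ 4 = a * q ^ 2 * q ^ 2 by ring, mul_assoc, ← h]
    ring
  have h2 : (1 + a * q ^ 3) * qShifted (-(a * q ^ 4 * q ^ 3)) (q ^ 4) k =
      qShifted (-(a * q ^ 3)) (q ^ 4) k * (1 + a * q ^ (3 + 4 * k)) := by
    have h := qShifted_succ' (-(a * q ^ 3)) (q ^ 4) k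
    rw [qShifted_succ] at h
    rw [show -(a * q ^ 4 * q ^ 3) = -(a * q ^ 3) * q ^ 4 by ring]
    linear_combination -h
  have hB : qShifted (-(a * q ^ 3)) (q ^ 4) k ≠ 0 := by
    refine qShifted_ne_zero fun i _ h => ha (3 + 4 * i) ?_
    linear_combination -h
  have hB' : qShifted (-(a * q ^ 4 * q ^ 3)) (q ^ 4) k ≠ 0 := by
    refine qShifted_ne_zero fun i _ h => ha (7 + 4 * i) ?_
    linear_combination -h
  have h3 : (-(a * q ^ 4) / q) ^ k = (-a / q) ^ k * q ^ (4 * k) := by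
    rw [show -(a * q ^ 4) / q = -a / q * q ^ 4 by ring, mul_pow, ← pow_mul]
  have hD := ha (3 + 4 * k)
  have h0 := ha 3
  unfold quadTerm
  rw [h3]
  generalize qShifted (-(a * q ^ 3)) (q ^ 4) k = B at *
  generalize qShifted (-(a * q ^ 4 * q ^ 3)) (q ^ 4) k = B' at *
  generalize qShifted (q ^ 4) (q ^ 4) k = A at *
  generalize qShifted (-q) (q ^ 2) k = E at *
  generalize (-a / q) ^ k = F at *
  generalize (1 + a * q ^ (3 + 4 * k)) = D at *
  generalize 1 + a * q ^ 3 = c at *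
  have hB2 : B = c * B' / D := by field_simp; linear_combination -h2
  subst hB2
  rw [← div_div, ← div_div]
  have : E ^ 2 * q ^ (4 * k) * q ^ (3 * k ^ 2) * F * D ^ 2 / A / B' ^ 2 *
      ((1 - a) * (1 - a * q ^ 2) * qShifted (a * q ^ 4) (q ^ 2) k) =
      E ^ 2 * q ^ (4 * k) * q ^ (3 * k ^ 2) * F * D ^ 2 / A / B' ^ 2 *
      (qShifted a (q ^ 2) k * ((1 - a * q ^ (2 * k)) * (1 - a * q ^ (2 * k + 2)))) := by
    rw [h1]
  calc _ = _ := by ring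
    _ = _ := this
    _ = _ := by field_simp

/-- Multiplication by $(1+aq^{3+4k})^2$ turns the terms at $k+1$ and at $aq^4$ into polynomial
multiples of `quadTerm q a k`, leaving a polynomial identity. Summed over $k$, it relates the series
at $a$ to the series at $aq^4$. -/
theorem quadTerm_telescope {q a : K} (hq : q ≠ 0) (k : ℕ) (hk : q ^ (4 * (k + 1)) ≠ 1)
    (ha : ∀ i, 1 + a * q ^ i ≠ 0) :
    (1 + a * q ^ 3) ^ 2 * (quadTerm q a k * (1 - a * q ^ (6 * k))) =
      (1 - a) * (1 - a * q ^ 2) *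
        (quadTerm q (a * q ^ 4) k * (1 - a * q ^ 4 * q ^ (6 * k))) -
      (1 + a * q ^ 3) ^ 2 * ((1 - q ^ (4 * (k + 1))) * quadTerm q a (k + 1) -
        (1 - q ^ (4 * k)) * quadTerm q a k) := by
  have h1 := quadTerm_succ_mul hq k hk (ha _)
  have h2 := quadTerm_shift hq k ha
  have hD := pow_ne_zero 2 (ha (3 + 4 * k))
  apply mul_right_cancel₀ hD
  linear_combination (-(1 - a * q ^ 4 * q ^ (6 * k))) * h2 + (1 + a * q ^ 3) ^ 2 * h1

/-- A terminating quadratic summation: the series vanishes at `a = q^(-2N)`. -/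
theorem sum_quadTerm_eq_zero {q : K} (hq : q ≠ 0) {M : ℕ}
    (hM : ∀ k < M, q ^ (4 * (k + 1)) ≠ 1) (N : ℕ) :
    ∀ a : K, N < M → a * q ^ (2 * N) = 1 → (∀ i, 1 + a * q ^ i ≠ 0) →
      ∑ k ∈ range M, quadTerm q a k * (1 - a * q ^ (6 * k)) = 0 := by
  induction N using Nat.strong_induction_on with
  | _ N ih =>
    intro a hN haN ha
    apply (mul_eq_zero.1 (?_ : (1 + a * q ^ 3) ^ 2 * _ = 0)).resolve_left (pow_ne_zero 2 (ha 3))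
    rw [mul_sum, sum_congr rfl fun k hk => quadTerm_telescope hq k (hM k (mem_range.1 hk)) ha,
      sum_sub_distrib, ← mul_sum, ← mul_sum,
      sum_range_sub (fun k => (1 - q ^ (4 * k)) * quadTerm q a k)]
    -- The upper boundary term dies because $N<M$; the lower one carries $1-q^0=0$.
    have hz : quadTerm q a M = 0 := by
      rw [quadTerm, qShifted_eq_zero hN (by rw [← pow_mul, haN])]
      simp
    rw [hz]
    -- The shift $a\mapsto aq^4$ lowers $N$ by 2; for $N=0,1$ the prefactor $(1-a)(1-aq^2)$
    -- vanishes.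
    match N, ih, hN, haN with
    | 0, _, _, haN => simp [show a = 1 by simpa using haN]
    | 1, _, _, haN => simp [show a * q ^ 2 = 1 by simpa using haN]
    | N + 2, ih, hN, haN =>
      rw [ih N (by omega) (a * q ^ 4) (by omega) (by rw [← haN]; ring)
        fun i => by rw [mul_assoc, ← pow_add]; exact ha _]
      simp

/-- At $a=q$ one has $-a/q=-1$, and $[6k+1](1-q)$ gives the linear factor. -/
theorem cTerm_mul_one_sub {q : K} (hq : q ≠ 0) (k : ℕ) :
    cTerm q k * (1 - q) = quadTerm q q k * (1 - q * q ^ (6 * k)) := by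
  have h := qInteger_mul_one_sub q (6 * k + 1)
  have e : -q ^ 4 = -(q * q ^ 3) := by ring
  rw [pow_succ'] at h
  rw [cTerm, quadTerm, ← h, e, neg_div, div_self hq]
  ring

end Summation

/-! ### One block at a root of unity -/

section RootOfUnity

variable {K : Type*} [Field K] {ζ : K} {d : ℕ}

theorem one_add_pow_ne_zero_of_odd (h2 : (2 : K) ≠ 0) (hζ : ζ ^ d = 1) (hd : Odd d) (i : ℕ) :
    1 + ζ ^ i ≠ 0 := by
  intro h
  have h1 : (ζ ^ i) ^ d = 1 := by rw [← pow_mul, mul_comm, pow_mul, hζ, one_pow]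
  rw [show ζ ^ i = -1 by linear_combination h, hd.neg_one_pow] at h1
  exact h2 (by linear_combination -h1)

theorem pow_four_mul_ne_one (hζ : IsPrimitiveRoot ζ d) (hd : Odd d) {k : ℕ} (h0 : 0 < k)
    (hk : k < d) : ζ ^ (4 * k) ≠ 1 := by
  intro h
  have h1 : d ∣ 4 * k := hζ.dvd_of_pow_eq_one _ h
  have h2 : Nat.Coprime d 4 := by
    rw [show 4 = 2 ^ 2 by rfl]
    exact Nat.Coprime.pow_right 2 (Nat.coprime_two_right.2 hd)
  exact absurd (Nat.le_of_dvd h0 (h2.dvd_of_dvd_mul_left h1)) (by omega)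

theorem cTerm_root_eq_zero (hζ : ζ ^ d = 1) (hd : Odd d) {k : ℕ} (hk : d < 2 * k) :
    cTerm ζ k = 0 := by
  obtain ⟨m, rfl⟩ := hd
  rw [cTerm, qShifted_eq_zero (m := m) (by omega) (by rw [← hζ]; ring)]
  simp

theorem sum_cTerm_root_eq_zero (h2 : (2 : K) ≠ 0) (hζ : IsPrimitiveRoot ζ d) (hd : Odd d)
    (hd1 : 1 < d) : ∑ k ∈ range d, cTerm ζ k = 0 := by
  have hζ0 : ζ ≠ 0 := hζ.ne_zero (by omega)
  have hζ1 : 1 - ζ ≠ 0 := sub_ne_zero.2 (hζ.ne_one hd1).symm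
  have hadd := one_add_pow_ne_zero_of_odd h2 hζ.pow_eq_one hd
  obtain ⟨m, hm⟩ := id hd
  -- The truncation is needed: on the full range the condition $\zeta^{4(k+1)}\ne1$ fails at
  -- $k+1=d$.
  have hsub : ∑ k ∈ range d, cTerm ζ k = ∑ k ∈ range (m + 1), cTerm ζ k := by
    refine (sum_subset (range_subset_range.2 (by omega)) fun k _ hk => ?_).symm
    rw [mem_range] at hk
    exact cTerm_root_eq_zero hζ.pow_eq_one hd (by omega)
  rw [hsub]
  apply (mul_eq_zero.1 (?_ : _ * (1 - ζ) = 0)).resolve_right hζ1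
  rw [sum_mul, sum_congr rfl fun k _ => cTerm_mul_one_sub hζ0 k]
  refine sum_quadTerm_eq_zero hζ0 (fun k hk => pow_four_mul_ne_one hζ hd (by omega) (by omega)) m ζ
    (by omega) ?_ fun i => ?_
  · rw [← pow_succ', ← hm, hζ.pow_eq_one]
  · rw [← pow_succ']
    exact hadd _

end RootOfUnity

/-! ### Convolution squares with block structure -/

section Convolution

variable {R : Type*} [CommRing R] {d : ℕ} {C γ e : ℕ → R}

theorem sum_range_mul_add_eq_zero (he : ∀ r, ∀ s < d, e (d * r + s) = C r * γ s)
    (hγ : ∀ s, d < 2 * s → γ s = 0) (hsum : ∑ s ∈ range d, γ s = 0) (r s : ℕ) (hs : s ≤ d)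
    (hds : d < 2 * s) : ∑ j ∈ range (d * r + s), e j = 0 := by
  have hpart : ∀ r, ∑ j ∈ range s, e (d * r + j) = 0 := fun r => by
    rw [sum_congr rfl fun j hj => he r j (by rw [mem_range] at hj; omega), ← mul_sum,
      sum_subset (range_subset_range.2 hs) fun j _ hj => hγ j (by rw [mem_range] at hj; omega),
      hsum, mul_zero]
  have hfull : ∑ j ∈ range (d * r), e j = 0 := by
    induction r with
    | zero => simp
    | succ r ih =>
      rw [Nat.mul_succ, sum_range_add, ih,
        sum_congr rfl fun j hj => he r j (mem_range.1 hj), ← mul_sum, hsum]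
      simp
  rw [sum_range_add, hfull, hpart, add_zero]

/-- Convolution squares of sequences with a block product structure, supported in the first half
of each block and with vanishing block sums, have vanishing sums up to multiples of the block
length. -/
theorem sum_convolution_eq_zero (hd : Odd d)
    (he : ∀ r, ∀ s < d, e (d * r + s) = C r * γ s) (hγ : ∀ s, d < 2 * s → γ s = 0)
    (hsum : ∑ s ∈ range d, γ s = 0) {n : ℕ} (hn : d ∣ n) :
    ∑ k ∈ range n, ∑ j ∈ range (k + 1), e j * e (k - j) = 0 := by
  rw [sum_range_diag_flip n fun i j => e i * e j]
  refine sum_eq_zero fun i hi => ?_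
  rw [mem_range] at hi
  rw [← mul_sum]
  obtain ⟨m, rfl⟩ := hn
  have hdpos := hd.pos
  have hlt := Nat.mod_lt i hdpos
  have hi' := Nat.div_add_mod i d
  -- As $d$ is odd, $2(i\bmod d)\le d$ is strict, so the inner length is $dt+s$ with $s=d-(i\bmod
  -- d)$ and $d<2s$; $s=d$ is possible.
  rcases lt_or_ge d (2 * (i % d)) with h | h
  · rw [← hi', he _ _ hlt, hγ _ h]
    simp
  · have hdiv : i / d < m := Nat.div_lt_of_lt_mul hi
    obtain ⟨t, rfl⟩ := Nat.exists_eq_add_of_lt hdiv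
    have : d * (i / d + t + 1) - i = d * t + (d - i % d) := by
      have : d * (i / d + t + 1) = d * (i / d) + d * t + d := by ring
      omega
    obtain ⟨c, hc⟩ := hd
    rw [this, sum_range_mul_add_eq_zero he hγ hsum t _ (by omega) (by omega), mul_zero]

end Convolution

/-! ### Values of rational functions at a root of unity -/

section Values

variable {L : Type*} [Field L]

/-- The rational function `f` is regular at `ζ`, with value `z` there. -/
def HasValueAt (ζ : L) (f : RatFunc ℤ) (z : L) : Prop :=
  ∃ A B : ℤ[X], aeval ζ B ≠ 0 ∧
    f = algebraMap ℤ[X] (RatFunc ℤ) A / algebraMap ℤ[X] (RatFunc ℤ) B ∧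
    z = aeval ζ A / aeval ζ B

namespace HasValueAt

variable {ζ : L} {f g : RatFunc ℤ} {z w : L}

theorem algebraMap_ne_zero {B : ℤ[X]} (hB : aeval ζ B ≠ 0) :
    algebraMap ℤ[X] (RatFunc ℤ) B ≠ 0 := by
  rw [Ne, FaithfulSMul.algebraMap_eq_zero_iff]
  rintro rfl
  simp at hB

theorem polynomial (A : ℤ[X]) : HasValueAt ζ (algebraMap ℤ[X] (RatFunc ℤ) A) (aeval ζ A) :=
  ⟨A, 1, by simp, by simp, by simp⟩

theorem one : HasValueAt ζ 1 1 := by simpa using polynomial (ζ := ζ) 1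

theorem zero : HasValueAt ζ 0 0 := by simpa using polynomial (ζ := ζ) 0

theorem X : HasValueAt ζ RatFunc.X ζ := by
  simpa [RatFunc.algebraMap_X] using polynomial (ζ := ζ) Polynomial.X

theorem mul (hf : HasValueAt ζ f z) (hg : HasValueAt ζ g w) : HasValueAt ζ (f * g) (z * w) := by
  obtain ⟨A, B, hB, rfl, rfl⟩ := hf
  obtain ⟨A', B', hB', rfl, rfl⟩ := hg
  refine ⟨A * A', B * B', by simp [hB, hB'], ?_, ?_⟩ <;> rw [div_mul_div_comm] <;> simp

theorem add (hf : HasValueAt ζ f z) (hg : HasValueAt ζ g w) : HasValueAt ζ (f + g) (z + w) := by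
  obtain ⟨A, B, hB, rfl, rfl⟩ := hf
  obtain ⟨A', B', hB', rfl, rfl⟩ := hg
  refine ⟨A * B' + B * A', B * B', by simp [hB, hB'], ?_, ?_⟩
  · rw [div_add_div _ _ (algebraMap_ne_zero hB) (algebraMap_ne_zero hB')]
    simp
  · rw [div_add_div _ _ hB hB']
    simp

theorem neg (hf : HasValueAt ζ f z) : HasValueAt ζ (-f) (-z) := by
  obtain ⟨A, B, hB, rfl, rfl⟩ := hf
  exact ⟨-A, B, hB, by rw [map_neg, neg_div], by rw [map_neg, neg_div]⟩

theorem sub (hf : HasValueAt ζ f z) (hg : HasValueAt ζ g w) : HasValueAt ζ (f - g) (z - w) := by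
  simpa [sub_eq_add_neg] using hf.add hg.neg

theorem div (hf : HasValueAt ζ f z) (hg : HasValueAt ζ g w) (hw : w ≠ 0) :
    HasValueAt ζ (f / g) (z / w) := by
  obtain ⟨A, B, hB, rfl, rfl⟩ := hf
  obtain ⟨A', B', hB', rfl, rfl⟩ := hg
  have hA' : aeval ζ A' ≠ 0 := (div_ne_zero_iff.1 hw).1
  refine ⟨A * B', B * A', by simp [hB, hA'], ?_, ?_⟩ <;> rw [div_div_div_eq] <;> simp

theorem pow (hf : HasValueAt ζ f z) (n : ℕ) : HasValueAt ζ (f ^ n) (z ^ n) := by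
  induction n with
  | zero => simpa using one
  | succ n ih => simpa [pow_succ] using ih.mul hf

theorem sum {ι : Type*} {s : Finset ι} {F : ι → RatFunc ℤ} {v : ι → L}
    (h : ∀ i ∈ s, HasValueAt ζ (F i) (v i)) : HasValueAt ζ (∑ i ∈ s, F i) (∑ i ∈ s, v i) := by
  classical
  induction s using Finset.induction_on with
  | empty => simpa using zero
  | insert i s hi ih =>
    rw [sum_insert hi, sum_insert hi]
    exact (h i (mem_insert_self i s)).add (ih fun j hj => h j (mem_insert_of_mem hj))

theorem prod {ι : Type*} {s : Finset ι} {F : ι → RatFunc ℤ} {v : ι → L}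
    (h : ∀ i ∈ s, HasValueAt ζ (F i) (v i)) : HasValueAt ζ (∏ i ∈ s, F i) (∏ i ∈ s, v i) := by
  classical
  induction s using Finset.induction_on with
  | empty => simpa using one
  | insert i s hi ih =>
    rw [prod_insert hi, prod_insert hi]
    exact (h i (mem_insert_self i s)).mul (ih fun j hj => h j (mem_insert_of_mem hj))

theorem qShifted (hf : HasValueAt ζ f z) (hg : HasValueAt ζ g w) (n : ℕ) :
    HasValueAt ζ (qShifted f g n) (qShifted z w n) :=
  prod fun i _ => one.sub (hf.mul (hg.pow i))

theorem qInteger (hf : HasValueAt ζ f z) (n : ℕ) :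
    HasValueAt ζ (qInteger f n) (qInteger z n) :=
  sum fun i _ => hf.pow i

end HasValueAt

variable {ζ : L} {d : ℕ}

theorem one_sub_X_pow_ne_zero {k : ℕ} (hk : k ≠ 0) : (1 - RatFunc.X ^ k : RatFunc ℤ) ≠ 0 := by
  have h : (1 - Polynomial.X ^ k : ℤ[X]) ≠ 0 := by
    rw [← neg_sub, neg_ne_zero]
    exact (monic_X_pow_sub_C (1 : ℤ) hk).ne_zero
  have := (FaithfulSMul.algebraMap_eq_zero_iff ℤ[X] (RatFunc ℤ)).not.2 h
  simpa [RatFunc.algebraMap_X] using this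

/-- Cancelling $1-X^d$ leaves two geometric sums in $X^d$, whose terms are all 1 at $\zeta$. -/
theorem hasValueAt_one_sub_div [CharZero L] (hζ : ζ ^ d = 1) (hd : d ≠ 0) (a : ℕ) {b : ℕ}
    (hb : b ≠ 0) :
    HasValueAt ζ ((1 - RatFunc.X ^ (d * a)) / (1 - RatFunc.X ^ (d * b))) ((a : L) / b) := by
  have key : ∀ m, HasValueAt ζ (qInteger (RatFunc.X ^ d) m) (m : L) := fun m => by
    have := (HasValueAt.X.pow d).qInteger m (ζ := ζ)
    simpa [hζ, qInteger] using this
  have h := (key a).div (key b) (Nat.cast_ne_zero.2 hb)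
  rwa [pow_mul, pow_mul, ← qInteger_mul_one_sub (RatFunc.X ^ d), ← qInteger_mul_one_sub (RatFunc.X ^ d),
    mul_div_mul_right _ _ (one_sub_X_pow_ne_zero hd)]

/-- For $d=2m+1$ the factor $i=m$ above is $1-X^{d(2r+1)}$ and the last factor below is
$1-X^{d(4r+4)}$. Their zeros at $\zeta$ cancel, and the rest of the denominator is nonzero there. -/
theorem exists_hasValueAt_block [CharZero L] (hζ : IsPrimitiveRoot ζ d) (hd : Odd d) (r : ℕ) :
    ∃ z, HasValueAt ζ (qShifted (RatFunc.X * (RatFunc.X ^ 2) ^ (d * r)) (RatFunc.X ^ 2) d /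
      qShifted (RatFunc.X ^ 4 * (RatFunc.X ^ 4) ^ (d * r)) (RatFunc.X ^ 4) d) z := by
  obtain ⟨m, hm⟩ := id hd
  have hmem : m ∈ range d := mem_range.2 (by omega)
  have hnum : qShifted (RatFunc.X * (RatFunc.X ^ 2) ^ (d * r)) (RatFunc.X ^ 2 : RatFunc ℤ) d =
      (1 - RatFunc.X ^ (d * (2 * r + 1))) * ∏ i ∈ (range d).erase m,
        (1 - RatFunc.X * (RatFunc.X ^ 2) ^ (d * r) * (RatFunc.X ^ 2) ^ i) := by
    rw [qShifted, ← mul_prod_erase _ _ hmem]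
    congr 2
    simp only [← pow_mul, ← pow_add, ← pow_succ']
    congr 1
    rw [hm]
    ring
  have hden : qShifted (RatFunc.X ^ 4 * (RatFunc.X ^ 4) ^ (d * r)) (RatFunc.X ^ 4 : RatFunc ℤ) d =
      (1 - RatFunc.X ^ (d * (4 * r + 4))) *
        qShifted (RatFunc.X ^ 4 * (RatFunc.X ^ 4) ^ (d * r)) (RatFunc.X ^ 4) (2 * m) := by
    conv_lhs => rw [hm, qShifted_succ, mul_comm]
    rw [← hm]
    congr 2
    simp only [← pow_mul, ← pow_add]
    congr 1
    rw [hm]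
    ring
  have hpow : ∀ i, ζ ^ (d * i) = 1 := fun i => by rw [pow_mul, hζ.pow_eq_one, one_pow]
  rw [hnum, hden, mul_div_mul_comm]
  refine ⟨_, (hasValueAt_one_sub_div hζ.pow_eq_one hd.pos.ne' _ (by omega)).mul
    ((HasValueAt.prod fun i _ => HasValueAt.one.sub ((HasValueAt.X.mul
      ((HasValueAt.X.pow 2).pow _)).mul ((HasValueAt.X.pow 2).pow i))).div
      (((HasValueAt.X.pow 4).mul ((HasValueAt.X.pow 4).pow _)).qShifted (HasValueAt.X.pow 4) _)
      (qShifted_ne_zero fun i hi h => ?_))⟩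
  refine pow_four_mul_ne_one hζ hd (k := i + 1) (by omega) (by omega) ?_
  have h4 : (ζ ^ 4) ^ (d * r) = 1 := by rw [← pow_mul, mul_left_comm, hpow]
  rw [h4, mul_one] at h
  rw [← h]
  ring

theorem exists_hasValueAt_ratio [CharZero L] (hζ : IsPrimitiveRoot ζ d) (hd : Odd d) (r : ℕ) :
    ∃ z, HasValueAt ζ (qShifted RatFunc.X (RatFunc.X ^ 2) (d * r) /
      qShifted (RatFunc.X ^ 4) (RatFunc.X ^ 4) (d * r)) z := by
  induction r with
  | zero => exact ⟨1, by simpa [qShifted_zero] using HasValueAt.one⟩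
  | succ r ih =>
    obtain ⟨z, hz⟩ := ih
    obtain ⟨w, hw⟩ := exists_hasValueAt_block hζ hd r
    refine ⟨z * w, ?_⟩
    rw [Nat.mul_succ, qShifted_add, qShifted_add, mul_div_mul_comm]
    exact hz.mul hw

theorem exists_hasValueAt_cTerm [CharZero L] (hζ : IsPrimitiveRoot ζ d) (hd : Odd d) (hd1 : 1 < d)
    (r : ℕ) :
    ∃ C, ∀ s < d, HasValueAt ζ (cTerm RatFunc.X (d * r + s)) (C * cTerm ζ s) := by
  obtain ⟨z, hz⟩ := exists_hasValueAt_ratio hζ hd r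
  have hadd := one_add_pow_ne_zero_of_odd (two_ne_zero' L) hζ.pow_eq_one hd
  have hpow : ∀ i, ζ ^ (d * i) = 1 := fun i => by rw [pow_mul, hζ.pow_eq_one, one_pow]
  have hX := HasValueAt.X (ζ := ζ)
  have hne : ∀ n, qShifted (-ζ ^ 4) (ζ ^ 4) n ≠ 0 := fun n =>
    qShifted_ne_zero fun i _ h => hadd (4 + 4 * i) (by linear_combination -h)
  -- $C_r$ collects the first $dr$ factors of every product; all else depends only on $s$ at
  -- $\zeta$.
  refine ⟨(-1) ^ (d * r) * z * (qShifted (-ζ) (ζ ^ 2) (d * r) /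
    qShifted (-ζ ^ 4) (ζ ^ 4) (d * r)) ^ 2, fun s hs => ?_⟩
  have hshift : ∀ i, (ζ ^ i) ^ (d * r) = 1 := fun i => by rw [← pow_mul, mul_left_comm, hpow]
  have hv : ∀ {f : RatFunc ℤ} {v : L} (i : ℕ), HasValueAt ζ f v →
      HasValueAt ζ (qShifted (f * (RatFunc.X ^ i) ^ (d * r)) (RatFunc.X ^ i) s)
        (qShifted v (ζ ^ i) s) := fun {f v} i hf => by
    have := (hf.mul ((hX.pow i).pow (d * r))).qShifted (hX.pow i) s
    rwa [hshift, mul_one] at this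
  have hne4 : qShifted (ζ ^ 4) (ζ ^ 4) s ≠ 0 := qShifted_ne_zero fun i hi h =>
    pow_four_mul_ne_one hζ hd (k := i + 1) (by omega) (by omega) (by rw [← h]; ring)
  have hint : HasValueAt ζ (qInteger RatFunc.X (6 * (d * r + s) + 1))
      (qInteger ζ (6 * s + 1)) := by
    have h := hX.qInteger (6 * (d * r + s) + 1)
    have e : qInteger ζ (6 * (d * r + s) + 1) = qInteger ζ (6 * s + 1) := by
      apply mul_right_cancel₀ (sub_ne_zero.2 (hζ.ne_one hd1).symm)
      rw [qInteger_mul_one_sub, qInteger_mul_one_sub,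
        show 6 * (d * r + s) + 1 = d * (6 * r) + (6 * s + 1) by ring, pow_add, hpow, one_mul]
    rwa [e] at h
  have hq : HasValueAt ζ (RatFunc.X ^ (3 * (d * r + s) ^ 2)) (ζ ^ (3 * s ^ 2)) := by
    have h := hX.pow (3 * (d * r + s) ^ 2)
    rwa [show 3 * (d * r + s) ^ 2 = d * (3 * d * r ^ 2 + 6 * r * s) + 3 * s ^ 2 by ring,
      pow_add ζ, hpow, one_mul, ← show 3 * (d * r + s) ^ 2 =
      d * (3 * d * r ^ 2 + 6 * r * s) + 3 * s ^ 2 by ring] at h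
  have hsgn : HasValueAt ζ ((-1) ^ (d * r + s)) ((-1) ^ (d * r + s)) :=
    HasValueAt.one.neg.pow _
  have h := ((hsgn.mul (hz.mul
    (((((hX.neg).qShifted (hX.pow 2) (d * r)).div
      (((hX.pow 4).neg).qShifted (hX.pow 4) (d * r)) (hne _)).pow 2)))).mul
    (((hv 2 hX).div (hv 4 (hX.pow 4)) hne4).mul
      (((hv 2 hX.neg).div (hv 4 (hX.pow 4).neg) (hne _)).pow 2))).mul (hint.mul hq)
  convert h using 1
  · simp only [cTerm, qShifted_add, div_eq_mul_inv, mul_inv, mul_pow, inv_pow]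
    ring
  · simp only [cTerm, div_eq_mul_inv, mul_inv, mul_pow, inv_pow, pow_add]
    ring

theorem hasValueAt_sum_aTerm [CharZero L] (hζ : IsPrimitiveRoot ζ d) (hd : Odd d) (hd1 : 1 < d)
    {n : ℕ} (hn : d ∣ n) : HasValueAt ζ (∑ k ∈ range n, aTerm RatFunc.X k) 0 := by
  choose C hC using exists_hasValueAt_cTerm hζ hd hd1
  have he : ∀ k, HasValueAt ζ (cTerm RatFunc.X k) (C (k / d) * cTerm ζ (k % d)) := fun k => by
    have := hC (k / d) (k % d) (Nat.mod_lt k hd.pos)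
    rwa [Nat.div_add_mod] at this
  have h := HasValueAt.sum (s := range n) fun k _ =>
    HasValueAt.sum (s := range (k + 1)) fun j _ => (he j).mul (he (k - j))
  rwa [sum_convolution_eq_zero (C := C) (γ := cTerm ζ)
    (e := fun k => C (k / d) * cTerm ζ (k % d)) hd
    (fun r s hs => by
      simp only [Nat.mul_add_div hd.pos, Nat.div_eq_of_lt hs, Nat.mul_add_mod,
        Nat.mod_eq_of_lt hs, add_zero])
    (fun s hs => cTerm_root_eq_zero hζ.pow_eq_one hd hs)
    (sum_cTerm_root_eq_zero two_ne_zero hζ hd hd1) hn] at h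

/-- $\Phi_d$ is the minimal polynomial of $\zeta$ over $\mathbb{Z}$, so divisibility by it means
vanishing at $\zeta$; cross-multiplication carries this to the reduced numerator. -/
theorem cyclotomic_dvd_num_of_hasValueAt_zero [CharZero L] (hζ : IsPrimitiveRoot ζ d)
    (hd : 0 < d) {f : RatFunc ℤ} (h : HasValueAt ζ f 0) :
    cyclotomic d ℤ ∣ IsFractionRing.num ℤ[X] f := by
  have hmin := cyclotomic_eq_minpoly hζ hd
  have hint := hζ.isIntegral hd
  have hdvd : ∀ {A : ℤ[X]}, cyclotomic d ℤ ∣ A ↔ aeval ζ A = 0 := fun {A} => by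
    rw [hmin]
    exact (minpoly.isIntegrallyClosed_dvd_iff hint A).symm
  obtain ⟨A, B, hB, hf, h0⟩ := h
  have hA : aeval ζ A = 0 := (div_eq_zero_iff.1 h0.symm).resolve_right hB
  have hden : algebraMap ℤ[X] (RatFunc ℤ) (IsFractionRing.den ℤ[X] f) ≠ 0 := by
    rw [Ne, FaithfulSMul.algebraMap_eq_zero_iff]
    exact nonZeroDivisors.coe_ne_zero _
  have hcross : IsFractionRing.num ℤ[X] f * B = A * IsFractionRing.den ℤ[X] f := by
    apply FaithfulSMul.algebraMap_injective ℤ[X] (RatFunc ℤ)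
    rw [map_mul, map_mul, ← div_eq_div_iff hden (HasValueAt.algebraMap_ne_zero hB), ← hf]
    exact IsFractionRing.mk'_num_den' _ f
  have := congrArg (aeval ζ) hcross
  rw [map_mul, map_mul, hA, zero_mul] at this
  exact hdvd.2 ((mul_eq_zero.1 this).resolve_right hB)

end Values

/-! ### Assembling the cyclotomic factors -/

theorem isRelPrime_cyclotomic {m n : ℕ} (hm : 0 < m) (hmn : m ≠ n) (hn : 0 < n) :
    IsRelPrime (cyclotomic m ℤ) (cyclotomic n ℤ) := by
  rw [(cyclotomic.irreducible hm).isRelPrime_iff_not_dvd]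
  intro h
  have := (cyclotomic.irreducible hm).associated_of_dvd (cyclotomic.irreducible hn) h
  exact hmn (cyclotomic_injective
    (eq_of_monic_of_associated (cyclotomic.monic _ _) (cyclotomic.monic _ _) this))

theorem theorem1 (n : ℕ) (hn : Odd n) :
    RatCongr (qInteger (Polynomial.X : Polynomial ℤ) n)
      (∑ k ∈ Finset.range n, aTerm (RatFunc.X : RatFunc ℤ) k) 0 := by
  set S := ∑ k ∈ Finset.range n, aTerm (RatFunc.X : RatFunc ℤ) k with hS
  have hdvd : qInteger (Polynomial.X : ℤ[X]) n ∣ IsFractionRing.num ℤ[X] S := by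
    rw [qInteger, ← prod_cyclotomic_eq_geom_sum hn.pos ℤ]
    have hmem : ∀ d ∈ n.divisors.erase 1, d ∣ n ∧ 0 < d ∧ 1 < d := fun d hd => by
      rw [mem_erase, Nat.mem_divisors] at hd
      have := Nat.pos_of_dvd_of_pos hd.2.1 hn.pos
      exact ⟨hd.2.1, this, by omega⟩
    refine Finset.prod_dvd_of_isRelPrime (fun d hd e he hde => ?_) fun d hd => ?_
    · exact isRelPrime_cyclotomic (hmem d hd).2.1 hde (hmem e he).2.1
    · obtain ⟨hdn, hd0, hd1⟩ := hmem d hd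
      have hζ := Complex.isPrimitiveRoot_exp d hd0.ne'
      exact cyclotomic_dvd_num_of_hasValueAt_zero hζ hd0
        (hasValueAt_sum_aTerm hζ (hn.of_dvd_nat hdn) hd1 hdn)
  -- In lowest terms, a divisor of the numerator is automatically coprime to the denominator.
  refine ⟨IsFractionRing.num ℤ[X] S, IsFractionRing.den ℤ[X] S, nonZeroDivisors.coe_ne_zero _, ?_,
    hdvd, (IsFractionRing.num_den_reduced ℤ[X] S).of_dvd_left hdvd⟩
  rw [sub_zero]
  exact (IsFractionRing.mk'_num_den' _ S).symm
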